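/- Conventions. Let $A$ be a commutative $\mathbb R$-algebra with $1$. A quadratic module in $A$ is a set $M\subseteq A$ with $M+M\subseteq M$, $1\in M$ and $a^2M\subseteq M$ for all $a\in A$. $\mathrm{QM}(S)$ is the smallest quadratic module containing $S\subseteq A$, and $M$ is finitely generated if $M=\mathrm{QM}(f_1,\dots,f_s)$ for some $f_1,\dots,f_s\in A$. Equip $A$ with the finest locally convex vector space topology; $\overline M$ denotes the closure of $M$, and $M^{\ddagger}$ the sequential closure of $M$, i.e. the set of all limits of sequences from $M$. $M^{\vee\vee}$ is the set of all $x\in A$ with $L(x)\ge 0$ for every linear functional $L:A\to\mathbb R$ that is nonnegative on $M$. $\mathcal S(M)$ is the set of all unital $\mathbb R$-algebra homomorphisms $\alpha:A\to\mathbb R$ with $\alpha(M)\subseteq\mathbb R_{\ge0}$, and $\mathrm{Pos}(\mathcal S(M))=\{a\in A\mid \alpha(a)\ge 0\text{ for all }\alpha\in\mathcal S(M)\}$. The quadratic module $M$ is closed if $M=M^{\vee\vee}$, saturated if $M=\mathrm{Pos}(\mathcal S(M))$, and has the $\ddagger$-property if $M^{\ddagger}=\mathrm{Pos}(\mathcal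 S(M))$. For a subspace $V\subseteq A$, $\sum V^2$ is the set of finite sums of squares of elements of $V$. A stability map for a quadratic module $N$ with respect to generators $a_1,\dots,a_k$ of $N$ is a map $\Phi$ that assigns to each finite dimensional $\mathbb R$-subspace $U$ of $A$ a finite dimensional $\mathbb R$-subspace $\Phi(U)$ of $A$ such that $$N\cap U\subseteq\Big\{\sigma_0+\sigma_1a_1+\dots+\sigma_ka_k\ \Big|\ \sigma_0,\dots,\sigma_k\in\textstyle\sum \Phi(U)^2\Big\}.$$ Theorem. Let $A$ be a commutative $\mathbb R$-algebra with $1$ and $M\subseteq A$ a quadratic module. Let $b_1,\dots,b_t\in A$ and let $\lambda_i\le\Lambda_i$ $(i=1,\dots,t)$ be real numbers such that $\Lambda_i-b_i\in M$ and $b_i-\lambda_i\in M$ for all $i$. Put $\Lambda=\prod_{i=1}^t[\lambda_i,\Lambda_i]$ and, for $r\in\Lambda$ and an $\mathbb R[b_1,\dots,b_t]$-submodule $W$ of $A$, let $J_r(W)=\{\sum_{i=1}^t(b_i-r_i)w_i\mid w_1,\dots,w_t\in W\}$ and $J_r=J_r(A)$. (1) For every finitely generated $\mathbb R[b_1,\dots,b_t]$-submodule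 $W$ of $A$, $$\bigcap_{r\in\Lambda}\big(M+J_r(W)\big)\subseteq M^{\ddagger}.$$ (2) Suppose that $M=\mathrm{QM}(f_1,\dots,f_s)$ is finitely generated, and that there is one map $\Phi$ which, for every $r\in\Lambda$, is a stability map for $M+J_r$ with respect to the generators $f_1,\dots,f_s,\pm(b_1-r_1),\dots,\pm(b_t-r_t)$. If $M+J_r$ is closed for every $r\in\Lambda$, then $M^{\ddagger}=\overline M$. If $M+J_r$ is saturated for every $r\in\Lambda$, then $M$ has the $\ddagger$-property. -/

import Mathlib

open scoped Pointwise

noncomputable section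

namespace FibreTheorem

/-! ### The finest locally convex topology and the closures of a cone -/

section VectorSpace

variable (E : Type*) [AddCommGroup E] [Module ℝ E]

/-- `τ` makes the real vector space `E` a locally convex topological vector space. -/
def IsLocallyConvexTopology (τ : TopologicalSpace E) : Prop :=
  @IsTopologicalAddGroup E τ _ ∧ @ContinuousSMul ℝ E _ _ τ ∧ @LocallyConvexSpace ℝ E _ _ _ _ τ

/-- The finest locally convex vector space topology on `E`. In Mathlib's order on topologies
finer means smaller, so this is an infimum; `isLocallyConvexTopology_finest` shows that it is
itself locally convex. -/
@[reducible]
def finestLocallyConvexTopology : TopologicalSpace E :=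
  sInf {τ | IsLocallyConvexTopology E τ}

theorem isLocallyConvexTopology_finest :
    IsLocallyConvexTopology E (finestLocallyConvexTopology E) :=
  ⟨topologicalAddGroup_sInf fun _ h => h.1, continuousSMul_sInf fun _ h => h.2.1,
    LocallyConvexSpace.sInf fun _ h => h.2.2⟩

theorem finestLocallyConvexTopology_le {τ : TopologicalSpace E}
    (h : IsLocallyConvexTopology E τ) : finestLocallyConvexTopology E ≤ τ :=
  sInf_le h

variable {E}

/-- `M^‡`: the set of all limits of sequences from `M`, in the finest locally convex topology. -/
def ddagger (M : Set E) : Set E :=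
  @seqClosure E (finestLocallyConvexTopology E) M

/-- The closure of `M` in the finest locally convex topology. -/
def lcClosure (M : Set E) : Set E :=
  @closure E (finestLocallyConvexTopology E) M

/-- The double dual cone `M^{∨∨}`. -/
def doubleDual (M : Set E) : Set E :=
  {x | ∀ L : E →ₗ[ℝ] ℝ, (∀ m ∈ M, 0 ≤ L m) → 0 ≤ L x}

/-- `M` is closed if it equals its double dual cone. -/
def IsClosedCone (M : Set E) : Prop :=
  M = doubleDual M

end VectorSpace

/-! ### Quadratic modules -/

section Algebra

variable {A : Type*} [CommRing A] [Algebra ℝ A]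

/-- Quadratic modules: `M + M ⊆ M`, `1 ∈ M` and `A² · M ⊆ M`. -/
structure IsQuadraticModule (M : Set A) : Prop where
  add_mem : ∀ x ∈ M, ∀ y ∈ M, x + y ∈ M
  one_mem : 1 ∈ M
  sq_mul_mem : ∀ a : A, ∀ m ∈ M, a ^ 2 * m ∈ M

/-- `QM(S)`: the smallest quadratic module containing `S`. -/
def QM (S : Set A) : Set A :=
  ⋂₀ {N | IsQuadraticModule N ∧ S ⊆ N}

/-- `S(M)`: the real characters of `A` that are nonnegative on `M`. -/
def positivitySet (M : Set A) : Set (A →ₐ[ℝ] ℝ) :=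
  {α | ∀ a ∈ M, 0 ≤ α a}

/-- `Pos(Y)`: the elements of `A` that are nonnegative on the set `Y` of real characters. -/
def Pos (Y : Set (A →ₐ[ℝ] ℝ)) : Set A :=
  {a | ∀ α ∈ Y, 0 ≤ α a}

/-- `M` is saturated if `M = Pos(S(M))`. -/
def IsSaturated (M : Set A) : Prop :=
  M = Pos (positivitySet M)

/-- `M` has the `‡`-property if `M^‡ = Pos(S(M))`. -/
def HasDDaggerProperty (M : Set A) : Prop :=
  ddagger M = Pos (positivitySet M)

/-! ### Stability -/

/-- `∑ V²`: the (finite) sums of squares of elements of `V`. -/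
def sumsOfSquares (V : Submodule ℝ A) : Set A :=
  (AddSubmonoid.closure {x : A | ∃ v ∈ V, x = v ^ 2} : Set A)

/-- The elements `σ₀ + ∑ i, σ i * a i` with all of `σ₀`, `σ i` in `∑ V²`. -/
def boundedQM {ι : Type*} [Fintype ι] (a : ι → A) (V : Submodule ℝ A) : Set A :=
  {x | ∃ σ₀ ∈ sumsOfSquares V, ∃ σ : ι → A,
    (∀ i, σ i ∈ sumsOfSquares V) ∧ x = σ₀ + ∑ i, σ i * a i}

/-- `Φ` is a stability map for the quadratic module `M`, with respect to the generators `a i`: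
it assigns to every finite dimensional subspace `U` of `A` a finite dimensional subspace `Φ U`
such that the elements of `M ∩ U` have a representation in terms of the generators with
sums of squares of elements of `Φ U`. The values of `Φ` at other subspaces play no role. -/
def IsStabilityMap {ι : Type*} [Fintype ι] (M : Set A) (a : ι → A)
    (Φ : Submodule ℝ A → Submodule ℝ A) : Prop :=
  ∀ U : Submodule ℝ A, FiniteDimensional ℝ U →
    FiniteDimensional ℝ (Φ U) ∧ M ∩ (U : Set A) ⊆ boundedQM a (Φ U)

/-! ### Fibre modules -/

variable {t : ℕ}

/-- `J_r(W) = {∑ i, (b i - r i) w i | w i ∈ W}`. -/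
def fibreJ (b : Fin t → A) (r : Fin t → ℝ) (W : Set A) : Set A :=
  {x | ∃ w : Fin t → A, (∀ i, w i ∈ W) ∧ x = ∑ i, (b i - algebraMap ℝ A (r i)) * w i}

/-- The fibre module `M + J_r`, where `J_r = J_r(A)` is the ideal generated by the
elements `b i - r i`. -/
def fibreModule (M : Set A) (b : Fin t → A) (r : Fin t → ℝ) : Set A :=
  M + fibreJ b r Set.univ

/-- The canonical generators `f₁, …, f_s, ±(b₁ - r₁), …, ±(b_t - r_t)` of the fibre module
`M + J_r`, where `M` is generated by `f₁, …, f_s`. -/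
def fibreGenerators {s : ℕ} (f : Fin s → A) (b : Fin t → A) (r : Fin t → ℝ) :
    Fin s ⊕ (Fin t ⊕ Fin t) → A :=
  Sum.elim f (Sum.elim (fun i => b i - algebraMap ℝ A (r i))
    (fun i => -(b i - algebraMap ℝ A (r i))))

end Algebra

end FibreTheorem

end

open scoped Pointwise

namespace FibreTheorem

/-! ### Elements bounded with respect to the order of a quadratic module -/

section Cone

variable {A : Type*} [CommRing A]

/-! Write `u ≤ v` for `v - u ∈ M`. The `b i` are bounded, hence so is every element of `ℝ[b]`. If `x
= m + ∑ (b i - r i) v i` with `v i ∈ W`, expand `v i` in generators `w j` of `W` with bounded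
coefficients. Young's inequality then gives `x + C q ∑ (δ + (b i - r i)² / δ) ∈ M` for all `δ > 0`,
where `q = x² + 1 + ∑ (w j² + 1)` does not depend on `r`. Compactness of the box makes this uniform:
`x + q (ε + D ∑ (b i - y i)²) ∈ M` for all `y`, with one `D` (`exists_uniform_add_mul_mem`).

An approximate partition of unity by squares `h k²`, concentrated near points `y k` of the box
(`exists_sq_partition`), glues these certificates to `x + ε q ∈ M` (`add_smul_mem_of_fibrewise`).
Letting `ε → 0` along the fixed direction `q` puts `x` in `M^‡`.

For the second part, uniform stability confines the coefficients of `b i - r i` to one finitely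
generated `W`. -/

theorem IsQuadraticModule.sq_mem {M : Set A} (hM : IsQuadraticModule M) (a : A) : a ^ 2 ∈ M := by
  simpa using hM.sq_mul_mem a 1 hM.one_mem

theorem IsQuadraticModule.zero_mem {M : Set A} (hM : IsQuadraticModule M) : (0 : A) ∈ M := by
  simpa using hM.sq_mem 0

theorem IsQuadraticModule.sum_mem {M : Set A} (hM : IsQuadraticModule M) {ι : Type*} {s : Finset ι} {f : ι → A}
    (h : ∀ i ∈ s, f i ∈ M) : ∑ i ∈ s, f i ∈ M :=
  Finset.sum_induction f (· ∈ M) (fun a b ha hb => hM.add_mem a ha b hb) hM.zero_mem h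

variable [Algebra ℝ A] {M : Set A}

namespace IsQuadraticModule

theorem smul_mem (hM : IsQuadraticModule M) {c : ℝ} (hc : 0 ≤ c) {m : A} (hm : m ∈ M) :
    c • m ∈ M := by
  have h := hM.sq_mul_mem (algebraMap ℝ A (√c)) m hm
  rwa [← map_pow, Real.sq_sqrt hc, ← Algebra.smul_def] at h

theorem algebraMap_mem (hM : IsQuadraticModule M) {c : ℝ} (hc : 0 ≤ c) :
    algebraMap ℝ A c ∈ M := by
  rw [Algebra.algebraMap_eq_smul_one]
  exact hM.smul_mem hc hM.one_mem

/-- `M` need not be closed under products, but `(e - u)² (e + u) + (e + u)² (e - u) = 2e (e² - u²)`.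
-/
theorem sq_sub_sq_mem (hM : IsQuadraticModule M) {e : ℝ} (he : 0 < e) {u : A}
    (h₁ : algebraMap ℝ A e - u ∈ M) (h₂ : algebraMap ℝ A e + u ∈ M) :
    algebraMap ℝ A (e ^ 2) - u ^ 2 ∈ M := by
  have h := hM.smul_mem (c := 1 / (2 * e)) (by positivity)
    (hM.add_mem _ (hM.sq_mul_mem (algebraMap ℝ A e - u) _ h₂) _
      (hM.sq_mul_mem (algebraMap ℝ A e + u) _ h₁))
  have key : (algebraMap ℝ A e - u) ^ 2 * (algebraMap ℝ A e + u) +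
      (algebraMap ℝ A e + u) ^ 2 * (algebraMap ℝ A e - u) =
      (2 * e) • (algebraMap ℝ A (e ^ 2) - u ^ 2) := by algebra
  rwa [key, smul_smul, one_div_mul_cancel (by positivity), one_smul] at h

end IsQuadraticModule

/-- `a` lies between `-c` and `c` for the partial order defined by `M`. -/
def OrderBounded (M : Set A) (c : ℝ) (a : A) : Prop :=
  algebraMap ℝ A c - a ∈ M ∧ algebraMap ℝ A c + a ∈ M

namespace OrderBounded

theorem mono (hM : IsQuadraticModule M) {c d : ℝ} (hcd : c ≤ d) {a : A}
    (h : OrderBounded M c a) : OrderBounded M d a := by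
  have hd := hM.algebraMap_mem (sub_nonneg.2 hcd)
  constructor
  · convert hM.add_mem _ h.1 _ hd using 1
    algebra
  · convert hM.add_mem _ h.2 _ hd using 1
    algebra

theorem neg {c : ℝ} {a : A} (h : OrderBounded M c a) : OrderBounded M c (-a) := by
  constructor
  · simpa using h.2
  · simpa [sub_eq_add_neg] using h.1

theorem add (hM : IsQuadraticModule M) {c d : ℝ} {a b : A} (ha : OrderBounded M c a)
    (hb : OrderBounded M d b) : OrderBounded M (c + d) (a + b) := by
  constructor
  · convert hM.add_mem _ ha.1 _ hb.1 using 1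
    algebra
  · convert hM.add_mem _ ha.2 _ hb.2 using 1
    algebra

theorem smul (hM : IsQuadraticModule M) {c d : ℝ} (hd : 0 ≤ d) {a : A}
    (ha : OrderBounded M c a) : OrderBounded M (d * c) (d • a) := by
  constructor
  · convert hM.smul_mem hd ha.1 using 1
    algebra
  · convert hM.smul_mem hd ha.2 using 1
    algebra

theorem algebraMap_abs (hM : IsQuadraticModule M) (c : ℝ) :
    OrderBounded M |c| (algebraMap ℝ A c) := by
  constructor
  · rw [← map_sub]
    exact hM.algebraMap_mem (sub_nonneg.2 (le_abs_self c))
  · rw [← map_add]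
    exact hM.algebraMap_mem (by linarith [neg_abs_le c])

/-- Polarization: `f g = ((f + g) / 2)² - ((f - g) / 2)²`, where the subtracted square is bounded by
`sq_sub_sq_mem`. Rescaling first to `f = d a`, `g = c b` gives both factors the bound `c d`. -/
theorem mul (hM : IsQuadraticModule M) {c d : ℝ} (hc : 0 < c) (hd : 0 < d) {a b : A}
    (ha : OrderBounded M c a) (hb : OrderBounded M d b) : OrderBounded M (c * d) (a * b) := by
  have half : ∀ {f g : A}, OrderBounded M (c * d) f → OrderBounded M (c * d) g →
      algebraMap ℝ A ((c * d) ^ 2) + f * g ∈ M := by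
    intro f g hf hg
    have h := (hf.add hM hg.neg).smul hM (d := 1 / 2) (by norm_num)
    rw [show 1 / 2 * (c * d + c * d) = c * d by ring] at h
    convert hM.add_mem _ (hM.sq_sub_sq_mem (mul_pos hc hd) h.1 h.2) _
      (hM.sq_mem ((1 / 2 : ℝ) • (f + g))) using 1
    algebra
  have hf := ha.smul hM hd.le
  have hg := hb.smul hM hc.le
  rw [mul_comm d c] at hf
  have cancel : ∀ {z : A}, (c * d) • z ∈ M → z ∈ M := fun {z} hz => by
    have := hM.smul_mem (c := (c * d)⁻¹) (by positivity) hz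
    rwa [smul_smul, inv_mul_cancel₀ (by positivity), one_smul] at this
  constructor
  · apply cancel
    convert half hf hg.neg using 1
    algebra
  · apply cancel
    convert half hf hg using 1
    algebra

theorem pow (hM : IsQuadraticModule M) {c : ℝ} (hc : 0 < c) {a : A}
    (ha : OrderBounded M c a) (n : ℕ) : OrderBounded M (c ^ n) (a ^ n) := by
  induction n with
  | zero => simpa using OrderBounded.algebraMap_abs hM 1
  | succ n ih => rw [pow_succ, pow_succ]; exact ih.mul hM (pow_pos hc n) hc ha

end OrderBounded

/-- An element between `lo` and `hi` is order bounded. -/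
theorem orderBounded_of_mem (hM : IsQuadraticModule M) {b : A} {lo hi : ℝ}
    (hhi : algebraMap ℝ A hi - b ∈ M) (hlo : b - algebraMap ℝ A lo ∈ M) :
    OrderBounded M (|lo| + |hi|) b := by
  constructor
  · convert hM.add_mem _ hhi _ (hM.algebraMap_mem (c := |lo| + |hi| - hi)
      (by linarith [le_abs_self hi, abs_nonneg lo])) using 1
    algebra
  · convert hM.add_mem _ hlo _ (hM.algebraMap_mem (c := |lo| + |hi| + lo)
      (by linarith [neg_abs_le lo, abs_nonneg hi])) using 1
    algebra

theorem exists_orderBounded_of_mem_adjoin (hM : IsQuadraticModule M) {S : Set A}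
    (hS : ∀ b ∈ S, ∃ c, 0 < c ∧ OrderBounded M c b) {a : A} (ha : a ∈ Algebra.adjoin ℝ S) :
    ∃ c, 0 < c ∧ OrderBounded M c a := by
  induction ha using Algebra.adjoin_induction with
  | mem x hx => exact hS x hx
  | algebraMap r =>
    exact ⟨|r| + 1, by positivity, (OrderBounded.algebraMap_abs hM r).mono hM (by linarith)⟩
  | add x y _ _ hx hy =>
    obtain ⟨c, hc, hx⟩ := hx
    obtain ⟨d, hd, hy⟩ := hy
    exact ⟨c + d, add_pos hc hd, hx.add hM hy⟩
  | mul x y _ _ hx hy =>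
    obtain ⟨c, hc, hx⟩ := hx
    obtain ⟨d, hd, hy⟩ := hy
    exact ⟨c * d, mul_pos hc hd, hx.mul hM hc hd hy⟩

/-! ### Partitions of unity by squares -/

/-- Projecting a node onto `[lo, hi]` only brings it closer to `b`; this keeps the nodes of the
partition inside the box, where the hypothesis on fibres applies. -/
theorem sq_sub_sub_sq_sub_clamp_mem (hM : IsQuadraticModule M) {b : A} {lo hi : ℝ}
    (hle : lo ≤ hi) (hhi : algebraMap ℝ A hi - b ∈ M) (hlo : b - algebraMap ℝ A lo ∈ M) (z : ℝ) :
    (b - algebraMap ℝ A z) ^ 2 - (b - algebraMap ℝ A (max lo (min z hi))) ^ 2 ∈ M := by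
  rcases lt_or_ge z lo with h | h
  · rw [min_eq_left (h.le.trans hle), max_eq_left h.le]
    convert hM.smul_mem (sub_nonneg.2 h.le) (hM.add_mem _ (hM.smul_mem zero_le_two hlo) _
      (hM.algebraMap_mem (sub_nonneg.2 h.le))) using 1
    algebra
  rcases le_or_gt z hi with h' | h'
  · rw [min_eq_left h', max_eq_right h, sub_self]
    exact hM.zero_mem
  · rw [min_eq_right h'.le, max_eq_right hle]
    convert hM.smul_mem (sub_nonneg.2 h'.le) (hM.add_mem _ (hM.smul_mem zero_le_two hhi) _
      (hM.algebraMap_mem (sub_nonneg.2 h'.le))) using 1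
    algebra

/-- Square roots of the even terms of the Bernstein partition of unity of even degree `2 * n`. -/
noncomputable def evenBernsteinRoot (n : ℕ) (x : A) (k : ℕ) : A :=
  if Even k then
    algebraMap ℝ A √(2 * (2 * n).choose k) * x ^ (k / 2) * (1 - x) ^ ((2 * n - k) / 2)
  else 0

theorem evenBernsteinRoot_sq {n k : ℕ} (x : A) :
    evenBernsteinRoot n x k ^ 2 =
      (1 + (-1) ^ k) * (((2 * n).choose k : A) * x ^ k * (1 - x) ^ (2 * n - k)) := by
  unfold evenBernsteinRoot
  split_ifs with h
  · rw [mul_pow, mul_pow, ← map_pow, Real.sq_sqrt (by positivity), ← pow_mul, ← pow_mul,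
      Nat.div_mul_cancel h.two_dvd,
      Nat.div_mul_cancel ((even_two_mul n).tsub h).two_dvd, h.neg_one_pow]
    simp only [map_mul, map_ofNat, map_natCast]
    ring
  · rw [(Nat.not_even_iff_odd.1 h).neg_one_pow]
    ring

/-- Adding the binomial expansions of `(x + (1 - x))^(2n)` and `(-x + (1 - x))^(2n)` cancels the odd
terms and doubles the even ones. -/
theorem sum_evenBernsteinRoot_sq (n : ℕ) (x : A) :
    ∑ k ∈ Finset.range (2 * n + 1), evenBernsteinRoot n x k ^ 2 = 1 + (1 - 2 * x) ^ (2 * n) := by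
  have h₁ := add_pow x (1 - x) (2 * n)
  have h₂ := add_pow (-x) (1 - x) (2 * n)
  rw [show x + (1 - x) = 1 by ring, one_pow] at h₁
  rw [show -x + (1 - x) = 1 - 2 * x by ring] at h₂
  conv_rhs => rw [h₂]; lhs; rw [h₁]
  rw [← Finset.sum_add_distrib]
  refine Finset.sum_congr rfl fun k _ => ?_
  rw [evenBernsteinRoot_sq, neg_pow]
  ring

/-- Twice the Bernstein variance in degree `2n` is `4n x (1 - x)`. Passing to the doubled even terms
discards the odd ones, which are nonnegative multiples of squares times `x (1 - x)`. -/
theorem evenBernsteinRoot_variance (hM : IsQuadraticModule M) (n : ℕ) {x : A}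
    (hx : x * (1 - x) ∈ M) :
    (4 * n : ℝ) • (x * (1 - x)) -
      ∑ k ∈ Finset.range (2 * n + 1), evenBernsteinRoot n x k ^ 2 * (2 * n * x - k) ^ 2 ∈ M := by
  have hv := congr_arg (Polynomial.aeval x) (bernsteinPolynomial.variance ℝ (2 * n))
  simp only [bernsteinPolynomial, map_sum, map_mul, map_pow, map_sub, map_natCast,
    Polynomial.aeval_X, map_one, map_ofNat, nsmul_eq_mul, Nat.cast_mul, Nat.cast_ofNat] at hv
  have h4 : (4 * n : ℝ) • (x * (1 - x)) = 2 * (2 * n * x * (1 - x)) := by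
    rw [Algebra.smul_def]
    simp only [map_mul, map_ofNat, map_natCast]
    ring
  rw [h4, ← hv, Finset.mul_sum, ← Finset.sum_sub_distrib]
  refine hM.sum_mem fun k hk => ?_
  have hk : k ≤ 2 * n := by simpa [Nat.lt_succ_iff] using hk
  rw [evenBernsteinRoot_sq]
  rcases Nat.even_or_odd k with h | h
  · rw [h.neg_one_pow]
    convert hM.zero_mem using 1
    ring
  · rw [h.neg_one_pow]
    obtain ⟨p, rfl⟩ := h
    obtain ⟨m, hm⟩ : ∃ m, 2 * n - (2 * p + 1) = 2 * m + 1 := ⟨n - p - 1, by omega⟩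
    rw [hm]
    convert hM.smul_mem (c := 2 * ((2 * n).choose (2 * p + 1) : ℝ)) (by positivity)
      (hM.sq_mul_mem (x ^ p * (1 - x) ^ m * (2 * n * x - (2 * p + 1 : ℕ))) _ hx) using 1
    rw [Algebra.smul_def]
    simp only [map_mul, map_ofNat, map_natCast]
    ring

theorem exists_sq_partition_single (hM : IsQuadraticModule M) {b : A} {lo hi : ℝ}
    (hle : lo ≤ hi) (hhi : algebraMap ℝ A hi - b ∈ M) (hlo : b - algebraMap ℝ A lo ∈ M)
    {η : ℝ} (hη : 0 < η) :
    ∃ (n : ℕ) (h : ℕ → A) (y : ℕ → ℝ), (∀ k, y k ∈ Set.Icc lo hi) ∧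
      OrderBounded M η (∑ k ∈ Finset.range n, h k ^ 2 - 1) ∧
      algebraMap ℝ A η - ∑ k ∈ Finset.range n, h k ^ 2 * (b - algebraMap ℝ A (y k)) ^ 2 ∈ M := by
  set R : ℝ := |lo| + |hi| + 1 with hR
  have hR0 : 0 < R := by positivity
  have hb : OrderBounded M R b := (orderBounded_of_mem hM hhi hlo).mono hM (by linarith)
  -- The factor `1 / (2R)` bounds `u` by `1/2`, so that the error `(1 - 2x)^(2n) = u^(2n)` of the
  -- partition tends to zero.
  obtain ⟨u, hu⟩ : ∃ u : A, u = (-(1 / (2 * R))) • b := ⟨_, rfl⟩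
  have hub : OrderBounded M (1 / 2) u := by
    have := (hb.smul hM (d := 1 / (2 * R)) (by positivity)).neg
    rwa [show 1 / (2 * R) * R = 1 / 2 by field_simp, ← neg_smul, ← hu] at this
  obtain ⟨x, hx⟩ : ∃ x : A, x = (1 / 2 : ℝ) • (1 - u) := ⟨_, rfl⟩
  have hux : 1 - 2 * x = u := by rw [hx]; algebra
  have hbu : b = (-(2 * R)) • u := by
    rw [hu, smul_smul, show -(2 * R) * -(1 / (2 * R)) = 1 by field_simp, one_smul]
  have hx1 : x * (1 - x) = (1 / 4 : ℝ) • (1 - u ^ 2) := by rw [hx]; algebra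
  have hxM : x * (1 - x) ∈ M := by
    rw [hx1]
    have h1 := (hub.mono hM (d := 1) (by norm_num))
    simpa using hM.smul_mem (c := 1 / 4) (by norm_num) (hM.sq_sub_sq_mem one_pos h1.1 h1.2)
  obtain ⟨n, hn1, hn2, hn0⟩ : ∃ n : ℕ, (1 / 2 : ℝ) ^ n ≤ η ∧ 4 * R ^ 2 / n ≤ η ∧ 0 < n := by
    have e1 := (tendsto_pow_atTop_nhds_zero_of_lt_one (r := (1 / 2 : ℝ)) (by norm_num)
      (by norm_num)).eventually_le_const hη
    have e2 := (tendsto_const_div_atTop_nhds_zero_nat (4 * R ^ 2)).eventually_le_const hη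
    exact (e1.and (e2.and (Filter.eventually_gt_atTop 0))).exists
  have hn0' : (0 : ℝ) < n := by exact_mod_cast hn0
  -- Since `b = 4R (x - 1/2)`, this is the value of `b` at the Bernstein node `x = k / (2n)`.
  set z : ℕ → ℝ := fun k => 4 * R * (k / (2 * n) - 1 / 2) with hz
  refine ⟨2 * n + 1, evenBernsteinRoot n x, fun k => max lo (min (z k) hi), fun k =>
    ⟨le_max_left _ _, max_le hle (min_le_right _ _)⟩, ?_, ?_⟩
  · rw [sum_evenBernsteinRoot_sq, hux, add_sub_cancel_left]
    refine (hub.pow hM (by norm_num) (2 * n)).mono hM (le_trans ?_ hn1)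
    exact pow_le_pow_of_le_one (by norm_num) (by norm_num) (by omega)
  · have h1 := hM.smul_mem (c := (2 * R / n) ^ 2) (by positivity)
      (evenBernsteinRoot_variance hM n hxM)
    have h2 := hM.sum_mem (s := Finset.range (2 * n + 1)) fun k _ =>
      hM.sq_mul_mem (evenBernsteinRoot n x k) _ (sq_sub_sub_sq_sub_clamp_mem hM hle hhi hlo (z k))
    have h3 := hM.smul_mem (c := 4 * R ^ 2 / n) (by positivity) (hM.sq_mem u)
    have h4 := hM.algebraMap_mem (sub_nonneg.2 hn2)
    convert hM.add_mem _ (hM.add_mem _ h1 _ h2) _ (hM.add_mem _ h3 _ h4) using 1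
    have hs : (2 * R / n) ^ 2 • ∑ k ∈ Finset.range (2 * n + 1),
        evenBernsteinRoot n x k ^ 2 * (2 * n * x - k) ^ 2 =
        ∑ k ∈ Finset.range (2 * n + 1),
          evenBernsteinRoot n x k ^ 2 * (b - algebraMap ℝ A (z k)) ^ 2 := by
      rw [Finset.smul_sum]
      refine Finset.sum_congr rfl fun k _ => ?_
      have : b - algebraMap ℝ A (z k) = (2 * R / n) • (2 * n * x - k) := by
        have e : (2 * n * x - k : A) = algebraMap ℝ A n - algebraMap ℝ A n * u
            - algebraMap ℝ A k := by
          rw [hx]; simp only [map_natCast]; algebra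
        rw [e, hbu, hz, ← sub_eq_zero]
        have e2 : (4 * R * (k / (2 * n) - 1 / 2) : ℝ) = (2 * R / n) * (k - n) := by
          field_simp; ring
        have e3 : (2 * R : ℝ) = (2 * R / n) * n := by field_simp
        simp only [e2]
        generalize (2 * R / n : ℝ) = c at *
        rw [e3]
        algebra
      rw [this, smul_pow, mul_smul_comm]
    simp only [mul_sub, Finset.sum_sub_distrib, smul_sub, hs, hx1, map_sub]
    have e4 (v : A) : (2 * R / n : ℝ) ^ 2 • (4 * n : ℝ) • (1 / 4 : ℝ) • v =
        (4 * R ^ 2 / n : ℝ) • v := by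
      rw [smul_smul, smul_smul]
      congr 1
      field_simp
      ring
    rw [e4, e4, Algebra.algebraMap_eq_smul_one (4 * R ^ 2 / n : ℝ)]
    abel

end Cone

end FibreTheorem

namespace FibreTheorem

/-! ### Partitions over the box and gluing of fibrewise certificates -/

section Fibres

variable {A : Type*} [CommRing A] [Algebra ℝ A] {M : Set A}

/-- Induction on the coordinates, multiplying the partition found so far by a one-variable one. With
sums `σ`, `τ` and variances `T`, `S`, the product has sum `σ τ` and variance `T τ + σ S`; both are
controlled by `OrderBounded.mul`. -/
theorem exists_sq_partition (hM : IsQuadraticModule M) {ι : Type*} [DecidableEq ι] {b : ι → A}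
    {lo hi : ι → ℝ} (hle : ∀ i, lo i ≤ hi i) (hhi : ∀ i, algebraMap ℝ A (hi i) - b i ∈ M)
    (hlo : ∀ i, b i - algebraMap ℝ A (lo i) ∈ M) (s : Finset ι) {η : ℝ} (hη : 0 < η) :
    ∃ (K : Type) (_ : Fintype K) (h : K → A) (y : K → ι → ℝ),
      (∀ k i, y k i ∈ Set.Icc (lo i) (hi i)) ∧
      OrderBounded M η (∑ k, h k ^ 2 - 1) ∧
      algebraMap ℝ A η - ∑ k, h k ^ 2 * ∑ i ∈ s, (b i - algebraMap ℝ A (y k i)) ^ 2 ∈ M := by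
  induction s using Finset.induction_on generalizing η with
  | empty =>
    refine ⟨Unit, inferInstance, fun _ => 1, fun _ => lo, fun _ i => ⟨le_rfl, hle i⟩, ?_, ?_⟩
    · simpa [OrderBounded] using hM.algebraMap_mem hη.le
    · simpa using hM.algebraMap_mem hη.le
  | insert a s ha ih =>
    -- With `θ ≤ 1` and `θ ≤ η / 4`, the error `2θ + θ²` of the sum and the variance bound `2θ + 2θ`
    -- are at most `η`.
    have hη' : 0 < min (η / 4) 1 := lt_min (by positivity) one_pos
    have h4 : min (η / 4) 1 ≤ η / 4 := min_le_left _ _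
    have h1 : min (η / 4) 1 ≤ 1 := min_le_right _ _
    generalize min (η / 4) 1 = θ at hη' h4 h1
    obtain ⟨K, _, h, y, hy, hσ, hT⟩ := ih hη'
    obtain ⟨n, g, z, hz, hτ, hS⟩ := exists_sq_partition_single hM (hle a) (hhi a) (hlo a) hη'
    rw [← Fin.sum_univ_eq_sum_range (fun k => g k ^ 2)] at hτ
    rw [← Fin.sum_univ_eq_sum_range (fun k => g k ^ 2 * (b a - algebraMap ℝ A (z k)) ^ 2)] at hS
    have hT0 : ∑ k, h k ^ 2 * ∑ i ∈ s, (b i - algebraMap ℝ A (y k i)) ^ 2 ∈ M :=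
      hM.sum_mem fun k _ => hM.sq_mul_mem _ _ (hM.sum_mem fun i _ => hM.sq_mem _)
    have hS0 : ∑ k : Fin n, g k ^ 2 * (b a - algebraMap ℝ A (z k)) ^ 2 ∈ M :=
      hM.sum_mem fun k _ => hM.sq_mul_mem _ _ (hM.sq_mem _)
    have bdd {T : A} (h0 : T ∈ M) (h : algebraMap ℝ A θ - T ∈ M) : OrderBounded M θ T :=
      ⟨h, hM.add_mem _ (hM.algebraMap_mem hη'.le) _ h0⟩
    have two {σ : A} (h : OrderBounded M θ (σ - 1)) : OrderBounded M 2 σ := by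
      have := (h.add hM (OrderBounded.algebraMap_abs hM 1)).mono hM (d := 2)
        (by rw [abs_one]; linarith)
      simpa using this
    refine ⟨K × Fin n, inferInstance, fun p => h p.1 * g p.2,
      fun p => Function.update (y p.1) a (z p.2), ?_, ?_, ?_⟩
    · intro p i
      by_cases hi : i = a
      · subst hi
        simpa using hz p.2
      · simpa [hi] using hy p.1 i
    · have := ((hσ.add hM hτ).add hM (hσ.mul hM hη' hη' hτ)).mono hM (d := η) (by nlinarith)
      convert this using 1
      simp only [mul_pow, Fintype.sum_prod_type, ← Finset.mul_sum, ← Finset.sum_mul]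
      ring
    · have := (((bdd hT0 hT).mul hM hη' two_pos (two hτ)).add hM
        ((two hσ).mul hM two_pos hη' (bdd hS0 hS))).mono hM (d := η) (by linarith)
      convert this.1 using 2
      have key (p : K × Fin n) : ∑ i ∈ insert a s,
          (b i - algebraMap ℝ A (Function.update (y p.1) a (z p.2) i)) ^ 2 =
          (b a - algebraMap ℝ A (z p.2)) ^ 2 +
            ∑ i ∈ s, (b i - algebraMap ℝ A (y p.1 i)) ^ 2 := by
        rw [Finset.sum_insert ha, Function.update_self]
        congr 1
        refine Finset.sum_congr rfl fun i hi => ?_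
        rw [Function.update_of_ne (ne_of_mem_of_not_mem hi ha)]
      simp only [key, mul_pow, Fintype.sum_prod_type, Finset.sum_mul_sum]
      rw [← Finset.sum_add_distrib]
      refine Finset.sum_congr rfl fun k _ => ?_
      rw [← Finset.sum_add_distrib]
      refine Finset.sum_congr rfl fun l _ => ?_
      ring

/-- Average `(w + 1)² (D + f)` and `(w - 1)² (D - f)`. This allows multiplication by an unbounded
`w`. -/
theorem smul_sq_add_one_add_mul_mem (hM : IsQuadraticModule M) {D f : A} (h₁ : D + f ∈ M)
    (h₂ : D - f ∈ M) (w : A) : (1 / 2 : ℝ) • (D * (w ^ 2 + 1)) + f * w ∈ M := by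
  convert hM.smul_mem (c := 1 / 4) (by norm_num) (hM.add_mem _ (hM.sq_mul_mem (w + 1) _ h₁) _
    (hM.sq_mul_mem (w - 1) _ h₂)) using 1
  algebra

/-- A weighted form of the inequality `2 |z| ≤ δ + z² / δ`. -/
theorem smul_add_mul_mem (hM : IsQuadraticModule M) {C : ℝ} {a : A} (ha : OrderBounded M C a)
    (z : A) {δ : ℝ} (hδ : 0 < δ) :
    C • (algebraMap ℝ A δ + δ⁻¹ • z ^ 2) + z * a ∈ M := by
  -- Completing the square: `δ + z² / δ + z = (z + δ / 2)² / δ + 3δ / 4`.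
  have young (z : A) {m : A} (hm : m ∈ M) : (algebraMap ℝ A δ + δ⁻¹ • z ^ 2 + z) * m ∈ M := by
    have hd : δ⁻¹ * δ = 1 := inv_mul_cancel₀ hδ.ne'
    have hd' : δ = δ⁻¹ * (δ * δ) := by rw [← mul_assoc, hd, one_mul]
    convert hM.add_mem _ (hM.smul_mem (c := δ⁻¹) (by positivity)
      (hM.sq_mul_mem (z + algebraMap ℝ A (δ / 2)) _ hm)) _
      (hM.smul_mem (c := 3 / 4 * δ) (by positivity) hm) using 1
    have e : δ⁻¹ • ((z + algebraMap ℝ A (δ / 2)) ^ 2 * m) =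
        δ⁻¹ • (z ^ 2 * m) + (δ⁻¹ * δ) • (z * m) + (δ⁻¹ * (δ * δ) / 4) • m := by
      algebra
    rw [e, ← hd', hd]
    algebra
  convert hM.smul_mem (c := 1 / 2) (by norm_num)
    (hM.add_mem _ (young z ha.2) _ (young (-z) ha.1)) using 1
  algebra

theorem exists_orderBounded_family (hM : IsQuadraticModule M) {S : Set A}
    (hS : ∀ b ∈ S, ∃ c, 0 < c ∧ OrderBounded M c b) {ι : Type*} [Fintype ι]
    (a : ι → Algebra.adjoin ℝ S) : ∃ c, 0 ≤ c ∧ ∀ i, OrderBounded M c (a i : A) := by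
  choose c hc h using fun i => exists_orderBounded_of_mem_adjoin hM hS (a i).2
  exact ⟨∑ i, c i, Finset.sum_nonneg fun i _ => (hc i).le, fun i => (h i).mono hM
    (Finset.single_le_sum (fun j _ => (hc j).le) (Finset.mem_univ i))⟩

variable {t : ℕ} {b : Fin t → A} {lo hi : Fin t → ℝ}

/-- Near `r` the certificate at `r` also serves `y`, because `(b - r)² ≤ 2 (b - y)² + 2 (y - r)²`.
Enlarging `D` is harmless, so finitely many neighbourhoods suffice. -/
theorem exists_uniform_add_mul_mem (hM : IsQuadraticModule M) {x q : A}
    (hq : ∀ m ∈ M, q * m ∈ M)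
    (hx : ∀ r ∈ Set.univ.pi (fun i => Set.Icc (lo i) (hi i)), ∃ C : ℝ, 0 ≤ C ∧ ∀ δ : ℝ, 0 < δ →
      x + C • (q * ∑ i, (algebraMap ℝ A δ + δ⁻¹ • (b i - algebraMap ℝ A (r i)) ^ 2)) ∈ M)
    {ε : ℝ} (hε : 0 < ε) :
    ∃ D : ℝ, 0 ≤ D ∧ ∀ y ∈ Set.univ.pi (fun i => Set.Icc (lo i) (hi i)),
      x + q * (algebraMap ℝ A ε + D • ∑ i, (b i - algebraMap ℝ A (y i)) ^ 2) ∈ M := by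
  have hqsum {c : ℝ} (hc : 0 ≤ c) (y : Fin t → ℝ) :
      q * (c • ∑ i, (b i - algebraMap ℝ A (y i)) ^ 2) ∈ M :=
    hq _ (hM.smul_mem hc (hM.sum_mem fun i _ => hM.sq_mem _))
  have hmono {D D' : ℝ} (h : D ≤ D') (y : Fin t → ℝ)
      (hy : x + q * (algebraMap ℝ A ε + D • ∑ i, (b i - algebraMap ℝ A (y i)) ^ 2) ∈ M) :
      x + q * (algebraMap ℝ A ε + D' • ∑ i, (b i - algebraMap ℝ A (y i)) ^ 2) ∈ M := by
    convert hM.add_mem _ hy _ (hqsum (sub_nonneg.2 h) y) using 1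
    algebra
  have hK : IsCompact (Set.univ.pi (fun i => Set.Icc (lo i) (hi i))) :=
    isCompact_univ_pi fun i => isCompact_Icc
  refine hK.induction_on (p := fun s => ∃ D : ℝ, 0 ≤ D ∧ ∀ y ∈ s,
    x + q * (algebraMap ℝ A ε + D • ∑ i, (b i - algebraMap ℝ A (y i)) ^ 2) ∈ M)
    ⟨0, le_rfl, by simp⟩ (fun s s' hs ⟨D, hD, h⟩ => ⟨D, hD, fun y hy => h y (hs hy)⟩) ?_ ?_
  · rintro s s' ⟨D, hD, h⟩ ⟨D', hD', h'⟩
    refine ⟨max D D', le_max_of_le_left hD, fun y hy => ?_⟩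
    rcases hy with hy | hy
    · exact hmono (le_max_left _ _) y (h y hy)
    · exact hmono (le_max_right _ _) y (h' y hy)
  · intro r hr
    obtain ⟨C, hC, h⟩ := hx r hr
    -- This `δ` spends at most `ε / 2` on the constant term `C t δ`; the neighbourhood below spends
    -- the other half on `y - r`.
    set δ : ℝ := ε / (2 * (C * t + 1)) with hδ
    have hδ0 : 0 < δ := by positivity
    have hCδ : C * (t * δ) ≤ ε / 2 := by
      rw [hδ, ← mul_assoc, mul_div_assoc', div_le_div_iff₀ (by positivity) two_pos]
      nlinarith [mul_nonneg hC (Nat.cast_nonneg' t : (0 : ℝ) ≤ t)]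
    refine ⟨{y | 2 * (C * δ⁻¹) * ∑ i, (y i - r i) ^ 2 < ε / 2}, mem_nhdsWithin_of_mem_nhds
      (IsOpen.mem_nhds (isOpen_lt (by fun_prop) continuous_const) (by simpa using hε)),
      2 * (C * δ⁻¹), by positivity, fun y hy => ?_⟩
    have h1 := h δ hδ0
    have h2 := hq _ (hM.smul_mem (c := C * δ⁻¹) (by positivity) (hM.sum_mem
      (s := Finset.univ) fun i _ => hM.sq_mem
        (b i - algebraMap ℝ A (y i) - algebraMap ℝ A (y i - r i))))
    have h3 := hq _ (hM.algebraMap_mem (c := ε - C * (t * δ) - 2 * (C * δ⁻¹) *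
      ∑ i, (y i - r i) ^ 2) (by
        have : 2 * (C * δ⁻¹) * ∑ i, (y i - r i) ^ 2 < ε / 2 := hy
        linarith))
    convert hM.add_mem _ (hM.add_mem _ h1 _ h2) _ h3 using 1
    have e : ∑ i, (b i - algebraMap ℝ A (y i) - algebraMap ℝ A (y i - r i)) ^ 2 =
        (2 : ℝ) • ∑ i, (b i - algebraMap ℝ A (y i)) ^ 2 +
        algebraMap ℝ A (2 * ∑ i, (y i - r i) ^ 2) -
        ∑ i, (b i - algebraMap ℝ A (r i)) ^ 2 := by
      rw [map_mul, map_sum, Finset.smul_sum, Finset.mul_sum, ← Finset.sum_add_distrib,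
        ← Finset.sum_sub_distrib]
      refine Finset.sum_congr rfl fun i _ => ?_
      algebra
    have e' : ∑ i, (algebraMap ℝ A δ + δ⁻¹ • (b i - algebraMap ℝ A (r i)) ^ 2) =
        algebraMap ℝ A (t * δ) + δ⁻¹ • ∑ i, (b i - algebraMap ℝ A (r i)) ^ 2 := by
      rw [Finset.sum_add_distrib, Finset.smul_sum]
      simp
    rw [e, e']
    generalize δ⁻¹ = d
    algebra

/-- Gluing of fibrewise approximate certificates by means of a partition of unity by squares. -/
theorem add_smul_mem_of_fibrewise (hM : IsQuadraticModule M) (hle : ∀ i, lo i ≤ hi i)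
    (hhi : ∀ i, algebraMap ℝ A (hi i) - b i ∈ M) (hlo : ∀ i, b i - algebraMap ℝ A (lo i) ∈ M)
    {x q : A} (hq : ∀ m ∈ M, q * m ∈ M) (hxq : q - (x ^ 2 + 1) ∈ M)
    (hx : ∀ r ∈ Set.univ.pi (fun i => Set.Icc (lo i) (hi i)), ∃ C : ℝ, 0 ≤ C ∧ ∀ δ : ℝ, 0 < δ →
      x + C • (q * ∑ i, (algebraMap ℝ A δ + δ⁻¹ • (b i - algebraMap ℝ A (r i)) ^ 2)) ∈ M)
    {ε : ℝ} (hε : 0 < ε) : x + ε • q ∈ M := by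
  obtain ⟨D, hD, hDx⟩ := exists_uniform_add_mul_mem hM hq hx (ε := ε / 4) (by positivity)
  have hη0 : 0 < min 1 (ε / (2 * (D + 1))) := lt_min one_pos (by positivity)
  have hη1 : min 1 (ε / (2 * (D + 1))) ≤ 1 := min_le_left _ _
  have hη2 : (D + 1) * min 1 (ε / (2 * (D + 1))) ≤ ε / 2 := by
    calc _ ≤ (D + 1) * (ε / (2 * (D + 1))) := by gcongr; exact min_le_right _ _
      _ = ε / 2 := by field_simp
  generalize min 1 (ε / (2 * (D + 1))) = η at hη0 hη1 hη2
  obtain ⟨K, _, h, y, hy, hσ, hT⟩ := exists_sq_partition hM hle hhi hlo Finset.univ hη0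
  have h1 := hM.sum_mem (s := Finset.univ) fun k _ =>
    hM.sq_mul_mem (h k) _ (hDx (y k) fun i _ => hy k i)
  have h2 := hM.smul_mem hD (hq _ hT)
  have h3 := hM.smul_mem (c := ε / 4) (by positivity) (hq _ hσ.1)
  -- The sum `σ` of the squares is only approximately `1`; the defect `(1 - σ) x` is absorbed by `η
  -- (x² + 1) / 2`, hence by `q`.
  have h4 := smul_sq_add_one_add_mul_mem hM hσ.neg.2 hσ.neg.1 x
  have h5 := hM.add_mem _ (hM.smul_mem hη0.le hxq) _ (hM.smul_mem (c := η / 2) (by positivity)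
    (hM.add_mem _ (hM.sq_mem x) _ hM.one_mem))
  have h6 := hq _ (hM.algebraMap_mem (c := ε - ε / 4 * (1 + η) - D * η - η) (by nlinarith))
  convert hM.add_mem _ (hM.add_mem _ (hM.add_mem _ h1 _ h2) _ (hM.add_mem _ h3 _ h4)) _
    (hM.add_mem _ h5 _ h6) using 1
  have e : ∑ k, h k ^ 2 * (x + q * (algebraMap ℝ A (ε / 4) +
      D • ∑ i, (b i - algebraMap ℝ A (y k i)) ^ 2)) =
      (∑ k, h k ^ 2) * (x + q * algebraMap ℝ A (ε / 4)) +
      D • (q * ∑ k, h k ^ 2 * ∑ i, (b i - algebraMap ℝ A (y k i)) ^ 2) := by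
    rw [Finset.sum_mul, Finset.mul_sum, Finset.smul_sum, ← Finset.sum_add_distrib]
    refine Finset.sum_congr rfl fun k _ => ?_
    algebra
  rw [e]
  algebra

theorem mem_ddagger_of_forall_add_smul_mem {E : Type*} [AddCommGroup E] [Module ℝ E] {M : Set E}
    {x q : E} (h : ∀ ε : ℝ, 0 < ε → x + ε • q ∈ M) : x ∈ ddagger M := by
  let _ := finestLocallyConvexTopology E
  obtain ⟨h1, h2, -⟩ := isLocallyConvexTopology_finest E
  refine ⟨fun n : ℕ => x + (1 / ((n : ℝ) + 1)) • q, fun n => h _ (by positivity), ?_⟩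
  simpa using (tendsto_const_nhds (x := x)).add
    ((tendsto_one_div_add_atTop_nhds_zero_nat (𝕜 := ℝ)).smul_const q)

/-- Only the bound `C` on the coefficients depends on `r`. The direction `q` is built from `x` and
generators of `W`, and is a sum of squares, so multiplication by it preserves `M`. -/
theorem iInter_fibre_subset_ddagger (hM : IsQuadraticModule M) (hle : ∀ i, lo i ≤ hi i)
    (hhi : ∀ i, algebraMap ℝ A (hi i) - b i ∈ M) (hlo : ∀ i, b i - algebraMap ℝ A (lo i) ∈ M)
    (W : Submodule (Algebra.adjoin ℝ (Set.range b)) A) (hW : W.FG) :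
    (⋂ r ∈ Set.univ.pi (fun i => Set.Icc (lo i) (hi i)), (M + fibreJ b r (W : Set A))) ⊆
      ddagger M := by
  intro x hx
  rw [Set.mem_iInter₂] at hx
  obtain ⟨n, w, rfl⟩ := Submodule.fg_iff_exists_fin_generating_family.1 hW
  have hS : ∀ a ∈ Set.range b, ∃ c, 0 < c ∧ OrderBounded M c a := by
    rintro _ ⟨i, rfl⟩
    exact ⟨|lo i| + |hi i| + 1, by positivity,
      (orderBounded_of_mem hM (hhi i) (hlo i)).mono hM (by linarith)⟩
  have hsq (a : A) : ∀ m ∈ M, (a ^ 2 + 1) * m ∈ M := fun m hm => by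
    rw [add_mul, one_mul]
    exact hM.add_mem _ (hM.sq_mul_mem a m hm) _ hm
  have hsum : ∀ m ∈ M, (∑ j, (w j ^ 2 + 1)) * m ∈ M := fun m hm => by
    rw [Finset.sum_mul]
    exact hM.sum_mem fun j _ => hsq _ m hm
  have hq : ∀ m ∈ M, (x ^ 2 + 1 + ∑ j, (w j ^ 2 + 1)) * m ∈ M := fun m hm => by
    rw [add_mul]
    exact hM.add_mem _ (hsq x m hm) _ (hsum m hm)
  refine mem_ddagger_of_forall_add_smul_mem fun ε hε =>
    add_smul_mem_of_fibrewise hM hle hhi hlo hq ?_ (fun r hr => ?_) hε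
  · simpa using hsum 1 hM.one_mem
  obtain ⟨m, hm, _, ⟨v, hv, rfl⟩, hxm⟩ := Set.mem_add.1 (hx r hr)
  choose c hc using fun i => (Submodule.mem_span_range_iff_exists_fun _).1 (hv i)
  obtain ⟨C, hC, hCc⟩ := exists_orderBounded_family hM hS (fun p : Fin t × Fin n => c p.1 p.2)
  refine ⟨C / 2, by positivity, fun δ hδ => ?_⟩
  set D : Fin t → A := fun i => algebraMap ℝ A δ + δ⁻¹ • (b i - algebraMap ℝ A (r i)) ^ 2 with hDdef
  have hDM : ∑ i, D i ∈ M := hM.sum_mem fun i _ => hM.add_mem _ (hM.algebraMap_mem hδ.le) _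
    (hM.smul_mem (by positivity) (hM.sq_mem _))
  -- The bounded factor `c i j` is handled by Young's inequality, then the generator `w j` by the
  -- averaging identity.
  have h1 (i : Fin t) (j : Fin n) : (1 / 2 : ℝ) • (C • D i * (w j ^ 2 + 1)) +
      (b i - algebraMap ℝ A (r i)) * c i j * w j ∈ M := by
    refine smul_sq_add_one_add_mul_mem hM (smul_add_mul_mem hM (hCc (i, j)) _ hδ) ?_ (w j)
    simpa [sub_eq_add_neg] using smul_add_mul_mem hM (hCc (i, j)).neg _ hδ
  have h2 := hM.sum_mem (s := Finset.univ) fun i _ => hM.sum_mem (s := Finset.univ) fun j _ =>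
    h1 i j
  have h3 := hM.smul_mem (c := C / 2) (by positivity) (hsq x _ hDM)
  convert hM.add_mem _ hm _ (hM.add_mem _ h2 _ h3) using 1
  have e : ∑ i, ∑ j, ((1 / 2 : ℝ) • (C • D i * (w j ^ 2 + 1)) +
      (b i - algebraMap ℝ A (r i)) * c i j * w j) =
      (C / 2) • ((∑ j, (w j ^ 2 + 1)) * ∑ i, D i) +
      ∑ i, (b i - algebraMap ℝ A (r i)) * v i := by
    rw [Finset.mul_sum, Finset.smul_sum, ← Finset.sum_add_distrib]
    refine Finset.sum_congr rfl fun i _ => ?_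
    rw [← hc i, Finset.sum_add_distrib, Finset.sum_mul, Finset.smul_sum, Finset.mul_sum]
    congr 1
    · refine Finset.sum_congr rfl fun j _ => ?_
      algebra
    · refine Finset.sum_congr rfl fun j _ => ?_
      rw [Algebra.smul_def, mul_assoc]
      rfl
  rw [e, ← add_assoc, ← add_assoc, add_right_comm m, hxm, add_mul, smul_add]
  abel

end Fibres

/-! ### Closures and the double dual cone -/

section Closure

variable {E : Type*} [AddCommGroup E] [Module ℝ E]

theorem continuous_linearMap_finest (L : E →ₗ[ℝ] ℝ) :
    @Continuous E ℝ (finestLocallyConvexTopology E) _ L := by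
  refine continuous_iff_le_induced.2 (finestLocallyConvexTopology_le E ⟨?_, ?_, ?_⟩)
  · exact topologicalAddGroup_induced L
  · exact continuousSMul_induced L
  · exact LocallyConvexSpace.induced L

theorem ddagger_subset_lcClosure (M : Set E) : ddagger M ⊆ lcClosure M :=
  @seqClosure_subset_closure E (finestLocallyConvexTopology E) M

theorem lcClosure_subset_doubleDual (M : Set E) : lcClosure M ⊆ doubleDual M := by
  let _ := finestLocallyConvexTopology E
  intro x hx L hL
  exact closure_minimal (t := L ⁻¹' Set.Ici 0) (fun m hm => hL m hm)
    (isClosed_Ici.preimage (continuous_linearMap_finest L)) hx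

theorem doubleDual_mono {M N : Set E} (h : M ⊆ N) : doubleDual M ⊆ doubleDual N :=
  fun _ hx L hL => hx L fun m hm => hL m (h hm)

end Closure

/-! ### Uniform stability of the fibre modules -/

section Stability

variable {A : Type*} [CommRing A]

theorem subset_QM (S : Set A) : S ⊆ QM S := Set.subset_sInter fun _ h => h.2

variable [Algebra ℝ A] {M : Set A}

theorem doubleDual_subset_Pos (M : Set A) : doubleDual M ⊆ Pos (positivitySet M) :=
  fun _ hx α hα => hx α.toLinearMap hα

theorem Pos_positivitySet_mono {M N : Set A} (h : M ⊆ N) :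
    Pos (positivitySet M) ⊆ Pos (positivitySet N) :=
  fun _ hx α hα => hx α fun m hm => hα m (h hm)

theorem IsQuadraticModule.sumsOfSquares_mul_mem (hM : IsQuadraticModule M) {V : Submodule ℝ A}
    {σ m : A} (hσ : σ ∈ sumsOfSquares V) (hm : m ∈ M) : σ * m ∈ M := by
  refine AddSubmonoid.closure_induction (motive := fun σ _ => σ * m ∈ M) ?_ ?_ ?_ hσ
  · rintro _ ⟨v, -, rfl⟩
    exact hM.sq_mul_mem v m hm
  · simpa using hM.zero_mem
  · intro a c _ _ ha hc
    rw [add_mul]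
    exact hM.add_mem _ ha _ hc

theorem sumsOfSquares_subset {V : Submodule ℝ A} : sumsOfSquares V ⊆ (V * V : Submodule ℝ A) := by
  have : AddSubmonoid.closure {x : A | ∃ v ∈ V, x = v ^ 2} ≤ (V * V).toAddSubmonoid := by
    rw [AddSubmonoid.closure_le]
    rintro _ ⟨v, hv, rfl⟩
    rw [pow_two]
    exact Submodule.mul_mem_mul hv hv
  exact this

variable {t : ℕ} {b : Fin t → A}

theorem subset_fibreModule (M : Set A) (b : Fin t → A) (r : Fin t → ℝ) :
    M ⊆ fibreModule M b r := fun m hm =>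
  Set.mem_add.2 ⟨m, hm, 0, ⟨0, by simp, by simp⟩, add_zero m⟩

/-- The generators `b i - r i` and their negatives merge into one term, whose coefficient is a
difference of two sums of squares and so lies in `V * V`. -/
theorem boundedQM_fibreGenerators_subset (hM : IsQuadraticModule M) {s : ℕ} {f : Fin s → A}
    (hf : ∀ i, f i ∈ M) (r : Fin t → ℝ) {V : Submodule ℝ A} {W : Set A}
    (hW : ∀ v ∈ V * V, v ∈ W) : boundedQM (fibreGenerators f b r) V ⊆ M + fibreJ b r W := by
  rintro _ ⟨σ₀, hσ₀, σ, hσ, rfl⟩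
  refine Set.mem_add.2 ⟨σ₀ + ∑ i, σ (.inl i) * f i, ?_, ∑ i, (b i - algebraMap ℝ A (r i)) *
    (σ (.inr (.inl i)) - σ (.inr (.inr i))), ⟨_, fun i => hW _ ?_, rfl⟩, ?_⟩
  · refine hM.add_mem _ ?_ _ (hM.sum_mem fun i _ => hM.sumsOfSquares_mul_mem (hσ _) (hf i))
    simpa using hM.sumsOfSquares_mul_mem hσ₀ hM.one_mem
  · exact sub_mem (sumsOfSquares_subset (hσ _)) (sumsOfSquares_subset (hσ _))
  · simp only [fibreGenerators, Fintype.sum_sum_type, Sum.elim_inl, Sum.elim_inr, add_assoc,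
      ← Finset.sum_add_distrib]
    congr 2
    refine Finset.sum_congr rfl fun i _ => ?_
    ring

/-- Under uniform stability, membership in all fibre modules implies membership in the
sequential closure. -/
theorem mem_ddagger_of_forall_mem_fibreModule (hM : IsQuadraticModule M) {lo hi : Fin t → ℝ}
    (hle : ∀ i, lo i ≤ hi i) (hhi : ∀ i, algebraMap ℝ A (hi i) - b i ∈ M)
    (hlo : ∀ i, b i - algebraMap ℝ A (lo i) ∈ M) {s : ℕ} {f : Fin s → A} (hf : ∀ i, f i ∈ M)
    {Φ : Submodule ℝ A → Submodule ℝ A}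
    (hΦ : ∀ r ∈ Set.univ.pi (fun i => Set.Icc (lo i) (hi i)),
      IsStabilityMap (fibreModule M b r) (fibreGenerators f b r) Φ) {x : A}
    (hx : ∀ r ∈ Set.univ.pi (fun i => Set.Icc (lo i) (hi i)), x ∈ fibreModule M b r) :
    x ∈ ddagger M := by
  -- `V` depends on `x` but not on `r`, so a finite spanning set of `V * V` generates one module `W`
  -- valid for all fibres.
  set V := Φ (Submodule.span ℝ {x}) with hV
  have hV' : FiniteDimensional ℝ V :=
    (hΦ lo (fun i _ => ⟨le_rfl, hle i⟩) (Submodule.span ℝ {x}) inferInstance).1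
  have hVfg : V.FG := Module.Finite.iff_fg.1 hV'
  obtain ⟨S, hS⟩ := hVfg.mul hVfg
  refine iInter_fibre_subset_ddagger hM hle hhi hlo
    (Submodule.span (Algebra.adjoin ℝ (Set.range b)) (S : Set A)) ⟨S, rfl⟩
    (Set.mem_iInter₂.2 fun r hr => ?_)
  refine boundedQM_fibreGenerators_subset hM hf r (V := V) (fun v hv => ?_)
    ((hΦ r hr (Submodule.span ℝ {x}) inferInstance).2
      ⟨hx r hr, Submodule.mem_span_singleton_self x⟩)
  rw [← hS] at hv
  exact Submodule.span_subset_span ℝ _ _ hv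

end Stability

end FibreTheorem

theorem mainTheorem1 {A : Type*} [CommRing A] [Algebra ℝ A] (M : Set A)
    (hM : FibreTheorem.IsQuadraticModule M) {t : ℕ} (b : Fin t → A) (lo hi : Fin t → ℝ)
    (hle : ∀ i, lo i ≤ hi i)
    (hhi : ∀ i, algebraMap ℝ A (hi i) - b i ∈ M)
    (hlo : ∀ i, b i - algebraMap ℝ A (lo i) ∈ M) :
    (∀ W : Submodule (Algebra.adjoin ℝ (Set.range b)) A, W.FG →
      (⋂ r ∈ Set.univ.pi (fun i => Set.Icc (lo i) (hi i)),
        (M + FibreTheorem.fibreJ b r (W : Set A))) ⊆ FibreTheorem.ddagger M) ∧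
    (∀ (s : ℕ) (f : Fin s → A), M = FibreTheorem.QM (Set.range f) →
      ∀ Φ : Submodule ℝ A → Submodule ℝ A,
      (∀ r ∈ Set.univ.pi (fun i => Set.Icc (lo i) (hi i)),
        FibreTheorem.IsStabilityMap (FibreTheorem.fibreModule M b r)
          (FibreTheorem.fibreGenerators f b r) Φ) →
      ((∀ r ∈ Set.univ.pi (fun i => Set.Icc (lo i) (hi i)),
          FibreTheorem.IsClosedCone (FibreTheorem.fibreModule M b r)) →
        FibreTheorem.ddagger M = FibreTheorem.lcClosure M) ∧
      ((∀ r ∈ Set.univ.pi (fun i => Set.Icc (lo i) (hi i)),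
          FibreTheorem.IsSaturated (FibreTheorem.fibreModule M b r)) →
        FibreTheorem.HasDDaggerProperty M)) := by
  refine ⟨fun W hW => FibreTheorem.iInter_fibre_subset_ddagger hM hle hhi hlo W hW,
    fun s f hMf Φ hΦ => ?_⟩
  have hf : ∀ i, f i ∈ M := fun i => hMf ▸ FibreTheorem.subset_QM _ ⟨i, rfl⟩
  constructor
  · intro hclosed
    refine (FibreTheorem.ddagger_subset_lcClosure M).antisymm fun x hx =>
      FibreTheorem.mem_ddagger_of_forall_mem_fibreModule hM hle hhi hlo hf hΦ fun r hr => ?_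
    rw [hclosed r hr]
    exact FibreTheorem.doubleDual_mono (FibreTheorem.subset_fibreModule M b r)
      (FibreTheorem.lcClosure_subset_doubleDual M hx)
  · intro hsat
    refine Set.Subset.antisymm ?_ fun x hx =>
      FibreTheorem.mem_ddagger_of_forall_mem_fibreModule hM hle hhi hlo hf hΦ fun r hr => ?_
    · exact (FibreTheorem.ddagger_subset_lcClosure M).trans
        ((FibreTheorem.lcClosure_subset_doubleDual M).trans (FibreTheorem.doubleDual_subset_Pos M))
    · rw [hsat r hr]
      exact FibreTheorem.Pos_positivitySet_mono (FibreTheorem.subset_fibreModule M b r) hx
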